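/- Let $G$ be a finite group. For $g \in G$ let $L_g$ be the $|G| \times |G|$ matrix, with rows and columns labelled by the elements of $G$, that sends the basis vector $|h\rangle$ to $|gh\rangle$ (the left regular representation), and let $$\mathcal{U}(G) := \Bigl\{ \sum_{g \in G} z_g L_g \in \mathrm{U}(|G|) : z_g \in \mathbb{C} \Bigr\}$$ be the set of all unitary matrices in the group algebra $\mathbb{C}[G]$. Then $\mathcal{U}(G)$ is a subgroup of the unitary group $\mathrm{U}(|G|)$, and $g \mapsto L_g$ is an injective group homomorphism from $G$ into $\mathrm{U}(|G|)$ whose image is contained in $\mathcal{U}(G)$. Moreover, $\mathcal{U}(G)$ is a continuous subgroup of $\mathrm{U}(|G|)$, meaning that it is closed, path-connected and not the one-element group. Finally, the set $\hat{G}$ of isomorphism classes of irreducible unitary representations $\tau : G \to \mathrm{U}(d_\tau)$, where $d_\tau$ is the dimension of $\tau$, is finite, and $\mathcal{U}(G)$ is isomorphic, as a topological group, to the direct sum (that is, the finite direct product) $\bigoplus_{\tau \in \hat{G}} \mathrm{U}(d_\tau)$ of unitary groups. -/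

import Mathlib

namespace UnitaryCayley

open Matrix

section Regular

variable (G : Type*) [Group G] [DecidableEq G]

/-- The matrix `L_g` of the left regular representation, in the standard basis of `ℂ^G`
(labelled by the elements of `G`): `L_g` sends the basis vector `y` to the basis vector `g * y`. -/
def leftRegularMatrix (g : G) : Matrix G G ℂ :=
  Matrix.of fun x y => if x = g * y then 1 else 0

theorem leftRegularMatrix_one : leftRegularMatrix G 1 = 1 := by
  ext x y
  simp [leftRegularMatrix, Matrix.one_apply]

theorem star_leftRegularMatrix (g : G) :
    star (leftRegularMatrix G g) = leftRegularMatrix G g⁻¹ := by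
  ext x y
  have : (y = g * x) ↔ (x = g⁻¹ * y) := by
    rw [eq_inv_mul_iff_mul_eq, eq_comm]
  simp [leftRegularMatrix, Matrix.star_apply, this, apply_ite (star : ℂ → ℂ)]

variable [Fintype G]

theorem leftRegularMatrix_mul (g h : G) :
    leftRegularMatrix G (g * h) = leftRegularMatrix G g * leftRegularMatrix G h := by
  ext x y
  simp [leftRegularMatrix, Matrix.mul_apply, mul_assoc]

theorem leftRegularMatrix_mem (g : G) : leftRegularMatrix G g ∈ unitaryGroup G ℂ := by
  rw [mem_unitaryGroup_iff, star_leftRegularMatrix, ← leftRegularMatrix_mul, mul_inv_cancel,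
    leftRegularMatrix_one]

/-- The left regular representation `g ↦ L_g`, as a homomorphism from `G` into the group `U(|G|)`
of unitary matrices whose rows and columns are labelled by the elements of `G`. -/
def leftRegular : G →* unitaryGroup G ℂ where
  toFun g := ⟨leftRegularMatrix G g, leftRegularMatrix_mem G g⟩
  map_one' := Subtype.ext (leftRegularMatrix_one G)
  map_mul' g h := Subtype.ext (leftRegularMatrix_mul G g h)

/-- The group of all unitary matrices in the group algebra `ℂ[G]`, i.e. of all unitary matrices
that are complex linear combinations of the matrices `L_g`. -/
def unitaryGroupAlgebra : Subgroup (unitaryGroup G ℂ) where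
  carrier := {U | ∃ z : G → ℂ, (U : Matrix G G ℂ) = ∑ g, z g • leftRegularMatrix G g}
  one_mem' := ⟨Pi.single 1 1, by simp [Pi.single_apply, ite_smul, leftRegularMatrix_one]⟩
  mul_mem' := by
    rintro U V ⟨z, hz⟩ ⟨w, hw⟩
    refine ⟨fun k => ∑ g, z g * w (g⁻¹ * k), ?_⟩
    rw [Submonoid.coe_mul, hz, hw, Finset.sum_mul]
    simp_rw [Finset.sum_smul, Finset.mul_sum]
    rw [Finset.sum_comm' (t' := Finset.univ) (s' := fun _ => Finset.univ) (by simp)]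
    conv_rhs => rw [Finset.sum_comm]
    rw [Finset.sum_comm]
    refine Finset.sum_congr rfl fun g _ => ?_
    refine Fintype.sum_equiv (Equiv.mulLeft g) _ _ fun h => ?_
    simp [leftRegularMatrix_mul, smul_smul, mul_comm]
  inv_mem' := by
    rintro U ⟨z, hz⟩
    refine ⟨fun g => star (z g⁻¹), ?_⟩
    have h : ((U⁻¹ : unitaryGroup G ℂ) : Matrix G G ℂ) = star (U : Matrix G G ℂ) := rfl
    rw [h, hz, star_sum]
    refine Fintype.sum_equiv (Equiv.inv G) _ _ fun g => ?_
    simp [star_smul, star_leftRegularMatrix]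

end Regular

/-- A subgroup of a unitary group is continuous if it is closed (hence a Lie subgroup), any two of
its elements are joined by a continuous path inside it, and it is not the one-element group
(so that it has positive dimension). -/
def IsContinuousSubgroup {n : Type*} [Fintype n] [DecidableEq n]
    (K : Subgroup (unitaryGroup n ℂ)) : Prop :=
  IsClosed (K : Set (unitaryGroup n ℂ)) ∧ IsPathConnected (K : Set (unitaryGroup n ℂ)) ∧ K ≠ ⊥

section Irreps

variable (G : Type*) [Group G]

/-- The linear action of `G` on `ℂ^d` given by a unitary matrix representation `τ : G → U(d)`. -/
def toRepresentation {G : Type*} [Group G] {d : ℕ} (τ : G →* unitaryGroup (Fin d) ℂ) :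
    Representation ℂ G (Fin d → ℂ) :=
  ((Matrix.toLinAlgEquiv' : Matrix (Fin d) (Fin d) ℂ ≃ₐ[ℂ] _) : _ →* _).comp
    ((unitaryGroup (Fin d) ℂ).subtype.comp τ)

theorem toRepresentation_apply {G : Type*} [Group G] {d : ℕ} (τ : G →* unitaryGroup (Fin d) ℂ)
    (g : G) (v : Fin d → ℂ) :
    toRepresentation τ g v = (τ g : Matrix (Fin d) (Fin d) ℂ) *ᵥ v := rfl

/-- An irreducible unitary matrix representation `τ : G → U(d)`, of some dimension `d`. -/
structure UnitaryIrrep where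
  dim : ℕ
  hom : G →* unitaryGroup (Fin dim) ℂ
  irreducible : (toRepresentation hom).IsIrreducible

/-- Isomorphism of irreducible representations. -/
instance UnitaryIrrep.setoid : Setoid (UnitaryIrrep G) where
  r τ σ := Nonempty ((toRepresentation τ.hom).Equiv (toRepresentation σ.hom))
  iseqv :=
    { refl := fun _ => ⟨.refl _⟩
      symm := fun ⟨e⟩ => ⟨e.symm⟩
      trans := fun ⟨e⟩ ⟨f⟩ => ⟨e.trans f⟩ }

/-- The dual `Ĝ`: the set of irreducible representations of `G` up to isomorphism. -/
def Dual : Type _ := Quotient (UnitaryIrrep.setoid G)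

/-- The dimension `d_τ` of `τ ∈ Ĝ`. -/
def Dual.dim {G : Type*} [Group G] : Dual G → ℕ :=
  Quotient.lift UnitaryIrrep.dim fun τ σ ⟨e⟩ => by
    simpa using LinearEquiv.finrank_eq e.toLinearEquiv

end Irreps

end UnitaryCayley

/-! The Fourier transform `z ↦ (τ(z))_τ` is a *-algebra isomorphism from `ℂ[G]` onto the product of
the matrix algebras `M_{d_τ}(ℂ)`, so it matches unitaries with unitaries. It is injective
(`eq_zero_of_fourier_eq_zero`): by Maschke, `ℂ^G` is a sum of simple modules, each unitary for the
restricted inner product, so an element killed by all irreducible representations kills `ℂ^G`, in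
particular the basis vector at `1`, whose image is `z` itself. It is surjective
(`exists_fourier_rep_eq`) because Schur orthogonality makes `invFourier` an explicit inverse. On
unitaries the map is a continuous bijection from a compact space to a Hausdorff one, hence a
homeomorphism; path-connectedness is carried back from the groups `U(d)`. -/

namespace UnitaryCayley

open Matrix

/-! ### The *-algebra `ℂ[G]` and its action through a unitary representation -/

section GroupAlgebraAction

variable {G : Type*} [Group G] [Fintype G] {n : Type*} [Fintype n] [DecidableEq n]

/-- The extension of a unitary matrix representation to the group algebra. -/
noncomputable def fourier (u : G →* unitaryGroup n ℂ) (z : G → ℂ) : Matrix n n ℂ :=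
  ∑ g, z g • (u g : Matrix n n ℂ)

/-- The product of the group algebra `ℂ[G]`, whose elements are viewed as functions on `G`. -/
noncomputable def conv (z w : G → ℂ) : G → ℂ := fun k => ∑ g, z g * w (g⁻¹ * k)

/-- The adjoint of an element of the group algebra `ℂ[G]`. -/
def conjInv (z : G → ℂ) : G → ℂ := fun g => star (z g⁻¹)

theorem fourier_conv (u : G →* unitaryGroup n ℂ) (z w : G → ℂ) :
    fourier u (conv z w) = fourier u z * fourier u w := by
  simp only [fourier, conv, Finset.sum_mul, Finset.sum_smul, Finset.mul_sum]
  rw [Finset.sum_comm]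
  conv_rhs => rw [Finset.sum_comm]
  refine Finset.sum_congr rfl fun g _ => ?_
  refine (Fintype.sum_equiv (Equiv.mulLeft g) _ _ fun h => ?_).symm
  simp [smul_smul, mul_comm]

theorem fourier_conjInv (u : G →* unitaryGroup n ℂ) (z : G → ℂ) :
    fourier u (conjInv z) = star (fourier u z) := by
  rw [fourier, fourier, star_sum]
  refine Fintype.sum_equiv (Equiv.inv G) _ _ fun g => ?_
  simp [conjInv, star_smul]

theorem fourier_single [DecidableEq G] (u : G →* unitaryGroup n ℂ) :
    fourier u (Pi.single 1 1) = 1 := by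
  simp [fourier, Pi.single_apply, ite_smul]

theorem fourier_leftRegular_apply_one [DecidableEq G] (z : G → ℂ) (g : G) :
    fourier (leftRegular G) z g 1 = z g := by
  simp [fourier, leftRegular, leftRegularMatrix, Matrix.sum_apply]

theorem mem_unitaryGroupAlgebra_iff [DecidableEq G] {U : unitaryGroup G ℂ} :
    U ∈ unitaryGroupAlgebra G ↔ ∃ z : G → ℂ, (U : Matrix G G ℂ) = fourier (leftRegular G) z :=
  Iff.rfl

end GroupAlgebraAction

/-! ### Schur orthogonality and Fourier inversion -/

section Schur

variable {G : Type*} [Group G] [Fintype G] {m n : ℕ}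

/-- The average of a matrix over the group, up to the factor `|G|`. -/
noncomputable def average (ρ : G →* unitaryGroup (Fin m) ℂ) (σ : G →* unitaryGroup (Fin n) ℂ)
    (X : Matrix (Fin m) (Fin n) ℂ) : Matrix (Fin m) (Fin n) ℂ :=
  ∑ g, (ρ g : Matrix (Fin m) (Fin m) ℂ) * X * star (σ g : Matrix (Fin n) (Fin n) ℂ)

theorem mul_average (ρ : G →* unitaryGroup (Fin m) ℂ) (σ : G →* unitaryGroup (Fin n) ℂ)
    (X : Matrix (Fin m) (Fin n) ℂ) (h : G) :
    (ρ h : Matrix (Fin m) (Fin m) ℂ) * average ρ σ X =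
      average ρ σ X * (σ h : Matrix (Fin n) (Fin n) ℂ) := by
  simp only [average, Matrix.mul_sum, Matrix.sum_mul]
  refine Fintype.sum_equiv (Equiv.mulLeft h) _ _ fun g => ?_
  have hs : star (σ h : Matrix (Fin n) (Fin n) ℂ) * (σ h : Matrix (Fin n) (Fin n) ℂ) = 1 :=
    UnitaryGroup.star_mul_self (σ h)
  simp only [Equiv.coe_mulLeft, map_mul, Submonoid.coe_mul, star_mul, Matrix.mul_assoc, hs,
    Matrix.mul_one]

/-- The average of a matrix, as an intertwining map. -/
noncomputable def averageMap (ρ : G →* unitaryGroup (Fin m) ℂ) (σ : G →* unitaryGroup (Fin n) ℂ)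
    (X : Matrix (Fin m) (Fin n) ℂ) :
    (toRepresentation σ).IntertwiningMap (toRepresentation ρ) where
  toLinearMap := (average ρ σ X).mulVecLin
  isIntertwining' g := by
    refine LinearMap.ext fun v => ?_
    simp [toRepresentation_apply, mulVec_mulVec, mul_average]

/-- Schur's lemma: the average intertwines two inequivalent irreducible representations. -/
theorem average_eq_zero {ρ : G →* unitaryGroup (Fin m) ℂ} {σ : G →* unitaryGroup (Fin n) ℂ}
    (hρ : (toRepresentation ρ).IsIrreducible) (hσ : (toRepresentation σ).IsIrreducible)
    (h : IsEmpty ((toRepresentation σ).Equiv (toRepresentation ρ)))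
    (X : Matrix (Fin m) (Fin n) ℂ) : average ρ σ X = 0 := by
  have h0 : averageMap ρ σ X = 0 := Subsingleton.elim _ _
  have h1 := congrArg Representation.IntertwiningMap.toLinearMap h0
  exact Matrix.toLin'.map_eq_zero_iff.mp h1

theorem trace_average (ρ σ : G →* unitaryGroup (Fin n) ℂ) (h : ρ = σ)
    (X : Matrix (Fin n) (Fin n) ℂ) : (average ρ σ X).trace = Fintype.card G * X.trace := by
  subst h
  simp only [average, Matrix.trace_sum]
  have (g : G) : (ρ g * X * star (ρ g : Matrix (Fin n) (Fin n) ℂ)).trace = X.trace := by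
    rw [Matrix.trace_mul_comm, ← Matrix.mul_assoc, UnitaryGroup.star_mul_self, Matrix.one_mul]
  simp [this]

omit [Fintype G] in
theorem pos_of_isIrreducible {ρ : G →* unitaryGroup (Fin n) ℂ}
    (hρ : (toRepresentation ρ).IsIrreducible) : 0 < n := by
  rcases Nat.eq_zero_or_pos n with rfl | h
  · obtain ⟨x, y, hxy⟩ := hρ.toNontrivial
    exact (hxy (Subrepresentation.toSubmodule_injective
      (Subsingleton.elim _ _))).elim
  · exact h

/-- Over `ℂ`, Schur's lemma makes the average a scalar matrix, and its trace fixes the scalar. -/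
theorem average_self {ρ : G →* unitaryGroup (Fin n) ℂ}
    (hρ : (toRepresentation ρ).IsIrreducible) (X : Matrix (Fin n) (Fin n) ℂ) :
    average ρ ρ X = (Fintype.card G * X.trace / n : ℂ) • (1 : Matrix (Fin n) (Fin n) ℂ) := by
  obtain ⟨c, hc⟩ := (Representation.IsIrreducible.algebraMap_intertwiningMap_bijective_of_isAlgClosed
    (ρ := toRepresentation ρ)).2 (averageMap ρ ρ X)
  have h1 : average ρ ρ X = c • (1 : Matrix (Fin n) (Fin n) ℂ) := by
    refine Matrix.mulVec_injective.eq_iff.mp (funext fun v => ?_)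
    have := congrArg (fun f => f v) hc
    rw [Matrix.smul_mulVec, Matrix.one_mulVec]
    exact this.symm
  have hn : (n : ℂ) ≠ 0 := Nat.cast_ne_zero.mpr (pos_of_isIrreducible hρ).ne'
  have h2 := trace_average ρ ρ rfl X
  rw [h1, Matrix.trace_smul, Matrix.trace_one, Fintype.card_fin, smul_eq_mul] at h2
  rw [h1, ← h2, mul_div_assoc, div_self hn, mul_one]

/-- Averaging a matrix unit produces the pairings of matrix entries that occur in the orthogonality
relations. -/
theorem average_single_apply (ρ : G →* unitaryGroup (Fin m) ℂ) (σ : G →* unitaryGroup (Fin n) ℂ)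
    (i j : Fin m) (k l : Fin n) :
    average ρ σ (Matrix.single j l 1) i k = ∑ g, ρ g i j * star (σ g k l) := by
  rw [average, Matrix.sum_apply]
  refine Finset.sum_congr rfl fun g _ => ?_
  rw [Matrix.mul_apply, Finset.sum_eq_single l]
  · simp [Matrix.star_apply]
  · intro b _ hb
    rw [Matrix.mul_single_apply_of_ne _ _ _ _ _ hb, zero_mul]
  · simp

/-- **Schur orthogonality** for inequivalent representations. -/
theorem sum_mul_star_eq_zero {ρ : G →* unitaryGroup (Fin m) ℂ} {σ : G →* unitaryGroup (Fin n) ℂ}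
    (hρ : (toRepresentation ρ).IsIrreducible) (hσ : (toRepresentation σ).IsIrreducible)
    (h : IsEmpty ((toRepresentation σ).Equiv (toRepresentation ρ)))
    (i j : Fin m) (k l : Fin n) : ∑ g, ρ g i j * star (σ g k l) = 0 := by
  rw [← average_single_apply, average_eq_zero hρ hσ h, Matrix.zero_apply]

/-- **Schur orthogonality** for the matrix entries of one representation. -/
theorem sum_mul_star_self {ρ : G →* unitaryGroup (Fin n) ℂ}
    (hρ : (toRepresentation ρ).IsIrreducible) (i j k l : Fin n) :
    ∑ g, ρ g i j * star (ρ g k l) =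
      if i = k ∧ j = l then (Fintype.card G / n : ℂ) else 0 := by
  rw [← average_single_apply, average_self hρ]
  by_cases hik : i = k <;> by_cases hjl : j = l <;>
    simp [hik, hjl]

/-- The coefficients of the element of the group algebra supported on one irreducible
representation. -/
noncomputable def invFourier (ρ : G →* unitaryGroup (Fin n) ℂ) (A : Matrix (Fin n) (Fin n) ℂ) :
    G → ℂ :=
  fun g => (n / Fintype.card G : ℂ) * ∑ i, ∑ j, A i j * star (ρ g i j)

theorem fourier_invFourier_apply (ρ : G →* unitaryGroup (Fin n) ℂ)
    (σ : G →* unitaryGroup (Fin m) ℂ) (A : Matrix (Fin n) (Fin n) ℂ) (k l : Fin m) :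
    fourier σ (invFourier ρ A) k l =
      (n / Fintype.card G : ℂ) * ∑ i, ∑ j, A i j * ∑ g, σ g k l * star (ρ g i j) := by
  simp only [fourier, invFourier, Matrix.sum_apply, Matrix.smul_apply, smul_eq_mul, Finset.mul_sum,
    Finset.sum_mul]
  rw [Finset.sum_comm]
  refine Finset.sum_congr rfl fun i _ => ?_
  rw [Finset.sum_comm]
  refine Finset.sum_congr rfl fun j _ => Finset.sum_congr rfl fun g _ => ?_
  ring

theorem fourier_invFourier_of_isEmpty {ρ : G →* unitaryGroup (Fin n) ℂ}
    {σ : G →* unitaryGroup (Fin m) ℂ}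
    (hρ : (toRepresentation ρ).IsIrreducible) (hσ : (toRepresentation σ).IsIrreducible)
    (h : IsEmpty ((toRepresentation ρ).Equiv (toRepresentation σ)))
    (A : Matrix (Fin n) (Fin n) ℂ) : fourier σ (invFourier ρ A) = 0 := by
  ext k l
  simp only [fourier_invFourier_apply, sum_mul_star_eq_zero hσ hρ h, mul_zero,
    Finset.sum_const_zero, Matrix.zero_apply]

theorem fourier_invFourier_self {ρ : G →* unitaryGroup (Fin n) ℂ}
    (hρ : (toRepresentation ρ).IsIrreducible) (A : Matrix (Fin n) (Fin n) ℂ) :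
    fourier ρ (invFourier ρ A) = A := by
  ext k l
  have hn : (n : ℂ) ≠ 0 := Nat.cast_ne_zero.mpr (pos_of_isIrreducible hρ).ne'
  simp only [fourier_invFourier_apply, sum_mul_star_self hρ, mul_ite, mul_zero]
  -- Orthogonality leaves only `i = k`, `j = l`, where `n / |G|` cancels `|G| / n`.
  rw [Finset.sum_eq_single k, Finset.sum_eq_single l]
  · simp
    field_simp
  all_goals simp +contextual [eq_comm]

theorem fourier_sum {ι n : Type*} [Fintype n] [DecidableEq n] (s : Finset ι)
    (u : G →* unitaryGroup n ℂ) (z : ι → G → ℂ) :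
    fourier u (∑ i ∈ s, z i) = ∑ i ∈ s, fourier u (z i) := by
  simp only [fourier, Finset.sum_apply, Finset.sum_smul]
  exact Finset.sum_comm

end Schur

/-! ### Completeness: irreducible unitary representations separate `ℂ[G]` -/

section Unitarizable

/-- The left regular representation on the Hilbert space `ℂ^G`. -/
noncomputable def regularRep (G : Type*) [Group G] :
    Representation ℂ G (EuclideanSpace ℂ G) where
  toFun g :=
    { toFun := fun v => WithLp.toLp 2 fun x => v (g⁻¹ * x)
      map_add' := fun _ _ => rfl
      map_smul' := fun _ _ => rfl }
  map_one' := by ext v x; simp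
  map_mul' g h := by
    refine LinearMap.ext fun v => WithLp.ofLp_injective 2 (funext fun x => ?_)
    change v ((g * h)⁻¹ * x) = v (h⁻¹ * (g⁻¹ * x))
    rw [_root_.mul_inv_rev, mul_assoc]

theorem regularRep_apply {G : Type*} [Group G] (g : G) (v : EuclideanSpace ℂ G) (x : G) :
    regularRep G g v x = v (g⁻¹ * x) := rfl

variable {G : Type*} [Group G]

theorem inner_regularRep [Fintype G] (g : G) (v w : EuclideanSpace ℂ G) :
    inner ℂ (regularRep G g v) (regularRep G g w) = inner ℂ v w := by
  simp only [PiLp.inner_apply, regularRep_apply]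
  exact Fintype.sum_equiv (Equiv.mulLeft g⁻¹) _ _ fun x => rfl

/-- A finite-dimensional representation by isometries is, in an orthonormal basis, given by unitary
matrices. -/
theorem exists_unitary_equiv {W : Type*} [NormedAddCommGroup W] [InnerProductSpace ℂ W]
    [FiniteDimensional ℂ W] (ρ : Representation ℂ G W)
    (hρ : ∀ g v w, inner ℂ (ρ g v) (ρ g w) = inner ℂ v w) :
    ∃ (d : ℕ) (u : G →* unitaryGroup (Fin d) ℂ), Nonempty ((toRepresentation u).Equiv ρ) := by
  let b := stdOrthonormalBasis ℂ W
  have hmem (g : G) : LinearMap.toMatrix b.toBasis b.toBasis (ρ g) ∈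
      unitaryGroup (Fin (Module.finrank ℂ W)) ℂ := by
    rw [mem_unitaryGroup_iff']
    ext i j
    have h1 (k : Fin (Module.finrank ℂ W)) :
        star (LinearMap.toMatrix b.toBasis b.toBasis (ρ g)) i k =
          inner ℂ (ρ g (b i)) (b k) := by
      simp [Matrix.star_apply, LinearMap.toMatrix_apply, b.repr_apply_apply]
    have h2 (k : Fin (Module.finrank ℂ W)) :
        LinearMap.toMatrix b.toBasis b.toBasis (ρ g) k j = inner ℂ (b k) (ρ g (b j)) := by
      simp [LinearMap.toMatrix_apply, b.repr_apply_apply]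
    simp only [Matrix.mul_apply, h1, h2]
    rw [b.sum_inner_mul_inner, hρ, orthonormal_iff_ite.mp b.orthonormal, Matrix.one_apply]
  let u : G →* unitaryGroup (Fin (Module.finrank ℂ W)) ℂ :=
    { toFun := fun g => ⟨_, hmem g⟩
      map_one' := Subtype.ext (by
        change LinearMap.toMatrix b.toBasis b.toBasis (ρ 1) = 1
        rw [map_one, LinearMap.toMatrix_one])
      map_mul' := fun g h => Subtype.ext (by
        simp [Module.End.mul_eq_comp, LinearMap.toMatrix_comp b.toBasis b.toBasis b.toBasis]) }
  refine ⟨_, u, ⟨Representation.Equiv.symm (.mk b.toBasis.equivFun fun g => ?_)⟩⟩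
  refine LinearMap.ext fun v => ?_
  exact (LinearMap.toMatrix_mulVec_repr b.toBasis b.toBasis (ρ g) v).symm

theorem isIrreducible_of_equiv {V W : Type*} [AddCommGroup V] [Module ℂ V] [AddCommGroup W]
    [Module ℂ W] {ρ : Representation ℂ G V} {σ : Representation ℂ G W} (e : ρ.Equiv σ)
    (h : σ.IsIrreducible) : ρ.IsIrreducible := by
  rw [Representation.irreducible_iff_isSimpleModule_asModule] at h ⊢
  let f := Representation.IntertwiningMap.equivLinearMapAsModule ρ σ e.toIntertwiningMap
  have hf : Function.Bijective f := e.toLinearEquiv.bijective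
  exact IsSimpleModule.congr (LinearEquiv.ofBijective f hf)

/-- The inclusion of a submodule over the group algebra, as an intertwining map. -/
def inclusionMap {V : Type*} [AddCommGroup V] [Module ℂ V] {ρ : Representation ℂ G V}
    (N : Submodule (MonoidAlgebra ℂ G) ρ.asModule) :
    (Subrepresentation.ofSubmodule' N).toRepresentation.IntertwiningMap ρ where
  toLinearMap := (Subrepresentation.ofSubmodule' N).toSubmodule.subtype
  isIntertwining' _ := rfl

/-- The inclusion identifies the module of the subrepresentation with `N`, so simplicity transfers.
-/
theorem isIrreducible_ofSubmodule' {V : Type*} [AddCommGroup V] [Module ℂ V]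
    {ρ : Representation ℂ G V} (N : Submodule (MonoidAlgebra ℂ G) ρ.asModule)
    [IsSimpleModule (MonoidAlgebra ℂ G) N] :
    (Subrepresentation.ofSubmodule' N).toRepresentation.IsIrreducible := by
  rw [Representation.irreducible_iff_isSimpleModule_asModule]
  let f := Representation.IntertwiningMap.equivLinearMapAsModule _ _ (inclusionMap N)
  have hf : Function.Injective f := Subtype.val_injective
  have hr : LinearMap.range f = N := by
    ext x
    exact ⟨fun ⟨y, hy⟩ => hy ▸ y.2, fun hx => ⟨⟨x, hx⟩, rfl⟩⟩
  exact IsSimpleModule.congr ((LinearEquiv.ofInjective f hf).trans (LinearEquiv.ofEq _ _ hr))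

variable [Fintype G]

theorem sum_smul_intertwiningMap {V : Type*} [AddCommGroup V] [Module ℂ V]
    {n : ℕ} {u : G →* unitaryGroup (Fin n) ℂ} {ρ : Representation ℂ G V}
    (f : (toRepresentation u).IntertwiningMap ρ) (z : G → ℂ) (v : Fin n → ℂ) :
    ∑ g, z g • ρ g (f v) = f (fourier u z *ᵥ v) := by
  simp only [fourier, Matrix.sum_mulVec, Matrix.smul_mulVec, map_sum, map_smul,
    ← toRepresentation_apply, Representation.IntertwiningMap.isIntertwining]

/-- By Maschke the simple submodules span, so by linearity it suffices to treat `v` in one of them;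
there the action is equivalent to an irreducible unitary matrix representation, to which `hz`
applies. -/
theorem sum_smul_apply_eq_zero {V : Type*} [NormedAddCommGroup V] [InnerProductSpace ℂ V]
    [FiniteDimensional ℂ V] (ρ : Representation ℂ G V)
    (hρ : ∀ g v w, inner ℂ (ρ g v) (ρ g w) = inner ℂ v w) {z : G → ℂ}
    (hz : ∀ (d : ℕ) (u : G →* unitaryGroup (Fin d) ℂ), (toRepresentation u).IsIrreducible →
      fourier u z = 0) (v : V) : ∑ g, z g • ρ g v = 0 := by
  have hsimple (N : Submodule (MonoidAlgebra ℂ G) ρ.asModule)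
      (hN : IsSimpleModule (MonoidAlgebra ℂ G) N) (v : ρ.asModule) (hv : v ∈ N) :
      ∑ g, z g • ρ g (ρ.asModuleEquiv v) = 0 := by
    obtain ⟨d, u, ⟨e⟩⟩ := exists_unitary_equiv
      (Subrepresentation.ofSubmodule' N).toRepresentation fun g v w => hρ g v w
    have hu := isIrreducible_of_equiv e (isIrreducible_ofSubmodule' N)
    have h := sum_smul_intertwiningMap ((inclusionMap N).comp e.toIntertwiningMap) z
      (e.symm ⟨v, hv⟩)
    rw [hz d u hu, Matrix.zero_mulVec, map_zero] at h
    rw [← h]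
    have hv' : (inclusionMap N).comp e.toIntertwiningMap (e.symm ⟨v, hv⟩) = ρ.asModuleEquiv v :=
      congrArg Subtype.val (e.apply_symm_apply ⟨v, hv⟩)
    rw [hv']
  have hv : ρ.asModuleEquiv.symm v ∈ sSup {N : Submodule (MonoidAlgebra ℂ G) ρ.asModule |
      IsSimpleModule (MonoidAlgebra ℂ G) N} := by
    rw [IsSemisimpleModule.sSup_simples_eq_top]; trivial
  rw [sSup_eq_iSup'] at hv
  suffices ∀ v ∈ ⨆ N : {N : Submodule (MonoidAlgebra ℂ G) ρ.asModule |
      IsSimpleModule (MonoidAlgebra ℂ G) N}, N.1, ∑ g, z g • ρ g (ρ.asModuleEquiv v) = 0 by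
    simpa using this _ hv
  intro v hv
  induction hv using Submodule.iSup_induction' with
  | mem N x hx => exact hsimple N N.2 x hx
  | zero => simp
  | add x y _ _ hx hy => simp only [map_add, smul_add, Finset.sum_add_distrib, hx, hy, add_zero]

/-- An element of the group algebra that acts by zero in all irreducible unitary representations
is zero. -/
theorem eq_zero_of_fourier_eq_zero {z : G → ℂ}
    (hz : ∀ (d : ℕ) (u : G →* unitaryGroup (Fin d) ℂ), (toRepresentation u).IsIrreducible →
      fourier u z = 0) : z = 0 := by
  classical
  funext g
  have h := congrArg (fun w : EuclideanSpace ℂ G => w g)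
    (sum_smul_apply_eq_zero (regularRep G) inner_regularRep hz (EuclideanSpace.single 1 1))
  simpa [regularRep_apply, inv_mul_eq_one, Pi.single_apply, eq_comm] using h

end Unitarizable

/-! ### Path-connectedness of `U(n)` -/

section PathConnected

open scoped Matrix.Norms.L2Operator

/-- The unitary groups are path-connected. -/
instance pathConnectedSpace_unitaryGroup (n : Type*) [Fintype n] [DecidableEq n] :
    PathConnectedSpace (unitaryGroup n ℂ) := by
  refine PathConnectedSpace.mk ⟨1⟩ ?_
  have key (u : unitaryGroup n ℂ) : Joined 1 u := by
    let s : Circle → unitaryGroup n ℂ := fun c =>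
      ⟨(c : ℂ) • 1, by
        rw [mem_unitaryGroup_iff]
        simp [star_smul, smul_smul, ← Circle.coe_inv_eq_conj]⟩
    have hs : Continuous s := by fun_prop
    have : Infinite Circle := Set.infinite_univ_iff.mp <|
      isPreconnected_univ.infinite_of_nontrivial ⟨1, trivial, -1, trivial, fun h => by
        have := congrArg (Subtype.val : Circle → ℂ) h
        norm_num at this⟩
    -- The circle is infinite and the spectrum finite. For such a `c`, `c⁻¹u` omits the eigenvalue
    -- `-1`, so `u` is at distance less than `2` from the scalar `c` and can be joined to it; the
    -- scalar is joined to `1` along the circle.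
    obtain ⟨c, hc⟩ : ∃ c : Circle, -(c : ℂ) ∉ spectrum ℂ (u : Matrix n n ℂ) := by
      by_contra! h
      exact Set.infinite_of_injective_forall_mem (f := fun c : Circle => -(c : ℂ))
        (neg_injective.comp Circle.coe_injective) h (Matrix.finite_spectrum _)
    have h1 : s 1 = 1 := Subtype.ext (by simp [s])
    have h2 : Joined (1 : unitaryGroup n ℂ) (s c) := by
      rw [← h1]
      exact ((PathConnectedSpace.joined 1 c).map hs)
    refine h2.trans (Unitary.joined _ _ ?_)
    let r : ℂˣ := Circle.toUnits c
    have hw : ((r⁻¹ : ℂˣ) : ℂ) • (u : Matrix n n ℂ) ∈ unitary (Matrix n n ℂ) := by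
      have : (((s c)⁻¹ * u : unitaryGroup n ℂ) : Matrix n n ℂ) =
          ((r⁻¹ : ℂˣ) : ℂ) • (u : Matrix n n ℂ) := by
        change star ((c : ℂ) • (1 : Matrix n n ℂ)) * u = _
        simp [r, star_smul, ← Circle.coe_inv_eq_conj]
      rw [← this]
      exact Subtype.property _
    have hspec : -1 ∉ spectrum ℂ (r⁻¹ • (u : Matrix n n ℂ)) := by
      have : (-1 : ℂ) = r⁻¹ • (-(c : ℂ)) := by
        rw [Units.smul_def]; simp [r]
      rwa [this, spectrum.smul_mem_smul_iff]
    have hnorm := (Unitary.norm_sub_one_lt_two_iff hw).mpr hspec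
    have hc1 : (u : Matrix n n ℂ) - (s c : Matrix n n ℂ) =
        (c : ℂ) • (((r⁻¹ : ℂˣ) : ℂ) • (u : Matrix n n ℂ) - 1) := by
      simp [s, r, smul_sub, smul_smul]
    rw [hc1, norm_smul, Circle.norm_coe, one_mul]
    exact hnorm
  exact fun u v => (key u).symm.trans (key v)

end PathConnected

/-! ### Finiteness of `Ĝ` and bijectivity of the Fourier transform -/

section DualGroup

variable {G : Type*} [Group G]

theorem Dual.exists_rep (τ : Dual G) : ∃ (u : G →* unitaryGroup (Fin τ.dim) ℂ)
    (h : (toRepresentation u).IsIrreducible), Quotient.mk _ ⟨τ.dim, u, h⟩ = τ := by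
  induction τ using Quotient.inductionOn with
  | h τ => exact ⟨τ.hom, τ.irreducible, rfl⟩

/-- A unitary matrix representation in the class `τ ∈ Ĝ`. -/
noncomputable def Dual.rep (τ : Dual G) : G →* unitaryGroup (Fin τ.dim) ℂ :=
  τ.exists_rep.choose

theorem Dual.isIrreducible_rep (τ : Dual G) : (toRepresentation τ.rep).IsIrreducible :=
  τ.exists_rep.choose_spec.choose

theorem Dual.mk_rep (τ : Dual G) : Quotient.mk _ ⟨τ.dim, τ.rep, τ.isIrreducible_rep⟩ = τ :=
  τ.exists_rep.choose_spec.choose_spec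

theorem Dual.isEmpty_equiv {τ σ : Dual G} (h : τ ≠ σ) :
    IsEmpty ((toRepresentation τ.rep).Equiv (toRepresentation σ.rep)) := by
  refine ⟨fun e => h ?_⟩
  rw [← τ.mk_rep, ← σ.mk_rep]
  exact Quotient.sound ⟨e⟩

theorem Dual.dim_pos (τ : Dual G) : 0 < τ.dim := pos_of_isIrreducible τ.isIrreducible_rep

variable [Fintype G]

/-- Matrix entries of the inequivalent irreducible representations are linearly independent, so
there are only finitely many of them. -/
instance Dual.finite : Finite (Dual G) := by
  let f (τ : Dual G) : EuclideanSpace ℂ G :=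
    WithLp.toLp 2 fun g => τ.rep g ⟨0, τ.dim_pos⟩ ⟨0, τ.dim_pos⟩
  have hf (τ σ : Dual G) : inner ℂ (f τ) (f σ) =
      ∑ g, σ.rep g ⟨0, σ.dim_pos⟩ ⟨0, σ.dim_pos⟩ * star (τ.rep g ⟨0, τ.dim_pos⟩ ⟨0, τ.dim_pos⟩) := by
    simp [f, PiLp.inner_apply]
  -- The corner entries are pairwise orthogonal, with squared norm `|G| / d_τ ≠ 0`, in the
  -- finite-dimensional space `ℂ^G`.
  have hli : LinearIndependent ℂ f := by
    refine linearIndependent_of_ne_zero_of_inner_eq_zero (fun τ h => ?_) fun τ σ h => ?_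
    · have h1 := hf τ τ
      rw [sum_mul_star_self τ.isIrreducible_rep, h, inner_zero_left] at h1
      have hG : (Fintype.card G / τ.dim : ℂ) ≠ 0 :=
        div_ne_zero (by simp) (Nat.cast_ne_zero.mpr τ.dim_pos.ne')
      exact hG (by simpa using h1.symm)
    · refine (hf τ σ).trans ?_
      exact sum_mul_star_eq_zero σ.isIrreducible_rep τ.isIrreducible_rep
        (Dual.isEmpty_equiv h) _ _ _ _
  exact hli.finite

/-- Vanishing on the chosen representatives passes along isomorphisms to every irreducible unitary
representation. -/
theorem eq_zero_of_fourier_rep_eq_zero {z : G → ℂ} (hz : ∀ τ : Dual G, fourier τ.rep z = 0) :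
    z = 0 := by
  refine eq_zero_of_fourier_eq_zero fun d u hu => ?_
  let τ : Dual G := Quotient.mk _ ⟨d, u, hu⟩
  obtain ⟨e⟩ : Nonempty ((toRepresentation u).Equiv (toRepresentation τ.rep)) :=
    Quotient.exact τ.mk_rep.symm
  refine Matrix.mulVec_injective.eq_iff.mp (funext fun v => e.toLinearEquiv.injective ?_)
  rw [Matrix.zero_mulVec, map_zero]
  refine (sum_smul_intertwiningMap e.toIntertwiningMap z v).symm.trans ?_
  have h := congrArg (· *ᵥ e v) (hz τ)
  simpa [fourier, Matrix.sum_mulVec, Matrix.smul_mulVec, toRepresentation_apply] using h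

theorem fourier_rep_injective {z w : G → ℂ}
    (h : ∀ τ : Dual G, fourier τ.rep z = fourier τ.rep w) : z = w := by
  refine sub_eq_zero.mp (eq_zero_of_fourier_rep_eq_zero fun τ => ?_)
  rw [← sub_eq_zero.mpr (h τ)]
  simp [fourier, sub_smul]

theorem exists_fourier_rep_eq (A : (τ : Dual G) → Matrix (Fin τ.dim) (Fin τ.dim) ℂ) :
    ∃ z : G → ℂ, ∀ τ : Dual G, fourier τ.rep z = A τ := by
  have := Fintype.ofFinite (Dual G)
  refine ⟨∑ σ, invFourier σ.rep (A σ), fun τ => ?_⟩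
  rw [fourier_sum, Finset.sum_eq_single τ]
  · exact fourier_invFourier_self τ.isIrreducible_rep _
  · exact fun σ _ h => fourier_invFourier_of_isEmpty σ.isIrreducible_rep τ.isIrreducible_rep
      (Dual.isEmpty_equiv h) _
  · simp

end DualGroup

/-- The unitary groups are compact. -/
instance compactSpace_unitaryGroup (n : Type*) [Fintype n] [DecidableEq n] :
    CompactSpace (unitaryGroup n ℂ) := by
  refine isCompact_iff_compactSpace.mp ?_
  have hK : IsCompact {A : Matrix n n ℂ | ∀ i j, A i j ∈ Metric.closedBall (0 : ℂ) 1} := by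
    have h := isCompact_univ_pi fun _ : n => isCompact_univ_pi fun _ : n =>
      isCompact_closedBall (0 : ℂ) 1
    have hs : {A : Matrix n n ℂ | ∀ i j, A i j ∈ Metric.closedBall (0 : ℂ) 1} =
        (Set.univ.pi fun _ : n => Set.univ.pi fun _ : n => Metric.closedBall (0 : ℂ) 1) :=
      Set.ext fun A => ⟨fun h i _ j _ => h i j, fun h i j => h i trivial j trivial⟩
    rw [hs]
    exact h
  refine hK.of_isClosed_subset isClosed_unitary fun A hA i j => ?_
  rw [mem_closedBall_zero_iff]
  exact entry_norm_bound_of_unitary hA i j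

/-! ### The isomorphism of topological groups and its consequences -/

section Isomorphism

variable {G : Type*} [Group G] [Fintype G] [DecidableEq G]

/-- The coefficients of an element of the group algebra with respect to the matrices `L_g`. -/
def coefficients (U : Matrix G G ℂ) : G → ℂ := fun g => U g 1

theorem coefficients_fourier (z : G → ℂ) : coefficients (fourier (leftRegular G) z) = z :=
  funext (fourier_leftRegular_apply_one z)

theorem fourier_coefficients {U : unitaryGroup G ℂ} (hU : U ∈ unitaryGroupAlgebra G) :
    fourier (leftRegular G) (coefficients (U : Matrix G G ℂ)) = U := by
  obtain ⟨z, hz⟩ := mem_unitaryGroupAlgebra_iff.mp hU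
  rw [hz, coefficients_fourier]

theorem coefficients_mul {U V : unitaryGroup G ℂ} (hU : U ∈ unitaryGroupAlgebra G)
    (hV : V ∈ unitaryGroupAlgebra G) :
    coefficients (U * V : Matrix G G ℂ) = conv (coefficients (U : Matrix G G ℂ))
      (coefficients (V : Matrix G G ℂ)) := by
  rw [← coefficients_fourier (conv _ _), fourier_conv, fourier_coefficients hU,
    fourier_coefficients hV]

/-- Since the regular representation is faithful on `ℂ[G]`, unitarity becomes an identity in the
group algebra, which then holds in every representation. -/
theorem fourier_mem_unitaryGroup_leftRegular_iff (z : G → ℂ) :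
    fourier (leftRegular G) z ∈ unitaryGroup G ℂ ↔ conv z (conjInv z) = Pi.single 1 1 := by
  rw [mem_unitaryGroup_iff, ← fourier_conjInv, ← fourier_conv, ← fourier_single (leftRegular G)]
  exact (Function.LeftInverse.injective coefficients_fourier).eq_iff

theorem fourier_mem_unitaryGroup {n : Type*} [Fintype n] [DecidableEq n]
    (u : G →* unitaryGroup n ℂ) {z : G → ℂ} (hz : conv z (conjInv z) = Pi.single 1 1) :
    fourier u z ∈ unitaryGroup n ℂ := by
  rw [mem_unitaryGroup_iff, ← fourier_conjInv, ← fourier_conv, hz, fourier_single]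

/-- The Fourier transform on the unitary group of the group algebra. -/
noncomputable def fourierHom (G : Type*) [Group G] [Fintype G] [DecidableEq G] :
    unitaryGroupAlgebra G →* ((τ : Dual G) → unitaryGroup (Fin τ.dim) ℂ) where
  toFun U τ := ⟨fourier τ.rep (coefficients (U : Matrix G G ℂ)), fourier_mem_unitaryGroup _ <|
    (fourier_mem_unitaryGroup_leftRegular_iff _).mp <| by
      rw [fourier_coefficients U.2]; exact U.1.2⟩
  map_one' := by
    funext τ
    refine Subtype.ext ?_
    change fourier τ.rep (coefficients (1 : Matrix G G ℂ)) = 1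
    rw [← fourier_single (leftRegular G), coefficients_fourier, fourier_single]
  map_mul' U V := by
    funext τ
    refine Subtype.ext ?_
    change fourier τ.rep (coefficients (U.1 * V.1 : Matrix G G ℂ)) = _
    rw [coefficients_mul U.2 V.2, fourier_conv]
    rfl

theorem coe_fourierHom (U : unitaryGroupAlgebra G) (τ : Dual G) :
    (fourierHom G U τ : Matrix (Fin τ.dim) (Fin τ.dim) ℂ) =
      fourier τ.rep (coefficients (U : Matrix G G ℂ)) := rfl

theorem fourierHom_bijective : Function.Bijective (fourierHom G) := by
  refine ⟨fun U V h => ?_, fun A => ?_⟩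
  · have : coefficients (U : Matrix G G ℂ) = coefficients (V : Matrix G G ℂ) :=
      fourier_rep_injective fun τ => congrArg Subtype.val (congrFun h τ)
    refine Subtype.ext (Subtype.ext ?_)
    rw [← fourier_coefficients U.2, this, fourier_coefficients V.2]
  · obtain ⟨z, hz⟩ := exists_fourier_rep_eq fun τ => (A τ : Matrix (Fin τ.dim) (Fin τ.dim) ℂ)
    -- Injectivity on all of `ℂ[G]` lifts the unitarity of every `A τ` to the group algebra.
    have hu : conv z (conjInv z) = Pi.single 1 1 := fourier_rep_injective fun τ => by
      rw [fourier_conv, fourier_conjInv, hz, fourier_single]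
      exact mem_unitaryGroup_iff.mp (A τ).2
    refine ⟨⟨⟨fourier (leftRegular G) z, (fourier_mem_unitaryGroup_leftRegular_iff z).mpr hu⟩,
      z, rfl⟩, ?_⟩
    funext τ
    refine Subtype.ext ?_
    rw [coe_fourierHom, ← hz τ]
    exact congrArg _ (coefficients_fourier z)

theorem continuous_fourierHom : Continuous (fourierHom G) := by
  refine continuous_pi fun τ => Continuous.subtype_mk ?_ _
  refine continuous_finsetSum _ fun g _ => Continuous.fun_smul ?_ continuous_const
  exact (continuous_subtype_val.comp continuous_subtype_val).matrix_elem g 1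

/-- The coefficients can be read off the column at `1`, so membership is an equation between
continuous functions of `U`. -/
theorem isClosed_unitaryGroupAlgebra :
    IsClosed (unitaryGroupAlgebra G : Set (unitaryGroup G ℂ)) := by
  have : (unitaryGroupAlgebra G : Set (unitaryGroup G ℂ)) =
      {U : unitaryGroup G ℂ | fourier (leftRegular G) (coefficients (U : Matrix G G ℂ)) =
        (U : Matrix G G ℂ)} := by
    ext U
    exact ⟨fourier_coefficients, fun h => ⟨_, h.symm⟩⟩
  rw [this]
  refine isClosed_eq ?_ continuous_subtype_val
  refine continuous_finsetSum _ fun g _ => Continuous.fun_smul ?_ continuous_const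
  exact continuous_subtype_val.matrix_elem g 1

/-- The scalar `-1` is a nontrivial element, even when `G` is trivial. -/
theorem unitaryGroupAlgebra_ne_bot : unitaryGroupAlgebra G ≠ ⊥ := by
  intro h
  have hneg : ((-1 : unitaryGroup G ℂ) : Matrix G G ℂ) = -1 := rfl
  have hmem : (-1 : unitaryGroup G ℂ) ∈ unitaryGroupAlgebra G :=
    ⟨Pi.single 1 (-1), by
      simp [hneg, Pi.single_apply, ite_smul, leftRegularMatrix_one]⟩
  rw [h, Subgroup.mem_bot] at hmem
  have := congrArg (fun U : unitaryGroup G ℂ => (U : Matrix G G ℂ) 1 1) hmem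
  norm_num [hneg] at this

/-- The Fourier transform as an isomorphism of topological groups. -/
noncomputable def fourierEquiv (G : Type*) [Group G] [Fintype G] [DecidableEq G] :
    unitaryGroupAlgebra G ≃ₜ* ((τ : Dual G) → unitaryGroup (Fin τ.dim) ℂ) :=
  haveI : CompactSpace (unitaryGroupAlgebra G) :=
    isCompact_iff_compactSpace.mp isClosed_unitaryGroupAlgebra.isCompact
  { MulEquiv.ofBijective (fourierHom G) fourierHom_bijective with
    continuous_toFun := continuous_fourierHom
    continuous_invFun := Continuous.continuous_symm_of_equiv_compact_to_t2
      (f := (MulEquiv.ofBijective (fourierHom G) fourierHom_bijective).toEquiv)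
      continuous_fourierHom }

theorem isContinuousSubgroup_unitaryGroupAlgebra :
    IsContinuousSubgroup (unitaryGroupAlgebra G) := by
  refine ⟨isClosed_unitaryGroupAlgebra, ?_, unitaryGroupAlgebra_ne_bot⟩
  have : PathConnectedSpace (unitaryGroupAlgebra G) :=
    (fourierEquiv G).symm.toHomeomorph.surjective.pathConnectedSpace
      (fourierEquiv G).symm.continuous
  exact isPathConnected_iff_pathConnectedSpace.mpr this

theorem leftRegular_injective : Function.Injective (leftRegular G) := by
  intro g h hgh
  have := congrArg (fun U : unitaryGroup G ℂ => (U : Matrix G G ℂ) g 1) hgh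
  by_contra hne
  simp [leftRegular, leftRegularMatrix, hne] at this

theorem range_leftRegular_le : (leftRegular G).range ≤ unitaryGroupAlgebra G := by
  rintro _ ⟨g, rfl⟩
  exact ⟨Pi.single g 1, by simp [leftRegular, Pi.single_apply, ite_smul]⟩

end Isomorphism

end UnitaryCayley

theorem mainTheorem2 (G : Type*) [Group G] [Fintype G] [DecidableEq G] :
    Function.Injective (UnitaryCayley.leftRegular G) ∧
    (UnitaryCayley.leftRegular G).range ≤ UnitaryCayley.unitaryGroupAlgebra G ∧
    UnitaryCayley.IsContinuousSubgroup (UnitaryCayley.unitaryGroupAlgebra G) ∧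
    Finite (UnitaryCayley.Dual G) ∧
    Nonempty (UnitaryCayley.unitaryGroupAlgebra G ≃ₜ*
      ((τ : UnitaryCayley.Dual G) → Matrix.unitaryGroup (Fin τ.dim) ℂ)) :=
  ⟨UnitaryCayley.leftRegular_injective, UnitaryCayley.range_leftRegular_le,
    UnitaryCayley.isContinuousSubgroup_unitaryGroupAlgebra, UnitaryCayley.Dual.finite,
    ⟨UnitaryCayley.fourierEquiv G⟩⟩
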